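/- Let $\mathcal C$ be a small monoidal category in which all idempotents split (a Cauchy complete monoidal category). Work in $\mathbf{Prof}$, the bicategory of small categories, profunctors (composed by coends) and natural transformations, with monoidal product $\boxtimes$ given by the product of categories. Write $\otimes^*:\mathcal C\boxtimes\mathcal C\to\mathcal C$ and $\otimes_*:\mathcal C\to\mathcal C\boxtimes\mathcal C$ for the profunctors with values $\mathcal C(c,x\otimes y)$ and $\mathcal C(x\otimes y,c)$, and $I^*$, $I_*$ for those with values $\mathcal C(c,I)$, $\mathcal C(I,c)$; there are adjunctions $\otimes^*\dashv\otimes_*$ and $I^*\dashv I_*$ with units $\eta_\otimes,\eta_I$ and counits $\varepsilon_\otimes,\varepsilon_I$. (Composites are written in functional order, $G\circ F$ meaning "first $F$".) The nearly tracing 2-morphism of $\mathcal C$ is the counit $$\mathrm{NTr}:=\varepsilon_\otimes:\ \otimes^*\circ\otimes_*\Rightarrow \mathrm{id}_{\mathcal C},\qquad \int^{x,y}\mathcal C(b,x\otimes y)\times\mathcal C(x\otimes y,a)\to\mathcal C(b,a),\quad (g,f)\mapsto f\circ g,$$ natural in $a,b$ and compatible with the coend in $x,y$ (the analogues of tightening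 and sliding). Then $N=\mathrm{NTr}$ satisfies the nearly-tracing axioms, i.e. the following three equations of 2-morphisms in $\mathbf{Prof}$, in which structural isomorphisms of $\mathbf{Prof}$ are left implicit and associators and unitors denote also their adjoint mates: 1. (Vanishing, unit) The composite $$\otimes^*\circ(\mathrm{id}\boxtimes I^*)\circ(\mathrm{id}\boxtimes I_*)\circ\otimes_*\ \xRightarrow{\ \varepsilon_I\ }\ \otimes^*\circ\otimes_*\ \xRightarrow{\ N\ }\ \mathrm{id}_{\mathcal C}$$ equals the canonical isomorphism given by the right unitor and its mate. 2. (Vanishing, tensor) The composite $$\otimes^*\circ(\mathrm{id}\boxtimes\otimes^*)\circ(\mathrm{id}\boxtimes\otimes_*)\circ\otimes_*\ \xRightarrow{\ \mathrm{id}\boxtimes\varepsilon_\otimes\ }\ \otimes^*\circ\otimes_*\ \xRightarrow{\ N\ }\ \mathrm{id}_{\mathcal C}$$ equals the composite that first rebrackets by the associator and its mate to $\otimes^*\circ(\otimes^*\boxtimes\mathrm{id})\circ(\otimes_*\boxtimes\mathrm{id})\circ\otimes_*$, then applies $N\boxtimes\mathrm{id}$ on the inside, then $N$. 3. (Superposing)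 The composite $$(\mathrm{id}\boxtimes\otimes^*)\circ(\mathrm{id}\boxtimes\otimes_*)\ \xRightarrow{\ \mathrm{id}\boxtimes N\ }\ \mathrm{id}\ \xRightarrow{\ \eta_\otimes\ }\ \otimes_*\circ\otimes^*$$ equals the composite that inserts $\eta_\otimes$ before and after, giving $\otimes_*\circ\otimes^*\circ(\mathrm{id}\boxtimes\otimes^*)\circ(\mathrm{id}\boxtimes\otimes_*)\circ\otimes_*\circ\otimes^*$, rebrackets the middle part by the associator and its mate to $\otimes_*\circ\otimes^*\circ(\otimes^*\boxtimes\mathrm{id})\circ(\otimes_*\boxtimes\mathrm{id})\circ\otimes_*\circ\otimes^*$, applies $\varepsilon_\otimes\boxtimes\mathrm{id}$ on the inside, and finally applies $N$ to the remaining $\otimes^*\circ\otimes_*$. -/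

import Mathlib

open CategoryTheory Opposite Bicategory

universe u

/-- The objects of the bicategory of profunctors: small categories. -/
structure Prof : Type (u + 1) where
  of ::
  carrier : Type u
  [cat : SmallCategory carrier]

namespace Prof

attribute [instance] Prof.cat

section Coend

variable {A B C : Type u} [SmallCategory A] [SmallCategory B] [SmallCategory C]

/-- The elementary moves `(p · β, q) ∼ (p, β · q)` in the disjoint union of the sets
`P(a, b) × Q(b, c)` over all `b`. -/
inductive CoendRel (P : Profunctor.{u} A B) (Q : Profunctor.{u} B C) (a : A) (c : Cᵒᵖ) :
    (Σ b : B, (P.obj a).obj (op b) × (Q.obj b).obj c) →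
    (Σ b : B, (P.obj a).obj (op b) × (Q.obj b).obj c) → Prop
  | move {b b' : B} (β : b ⟶ b') (p : (P.obj a).obj (op b')) (q : (Q.obj b).obj c) :
      CoendRel P Q a c ⟨b, (P.obj a).map β.op p, q⟩ ⟨b', p, (Q.map β).app c q⟩

/-- The coend `∫ b, P(a, b) × Q(b, c)`. -/
def CoendObj (P : Profunctor.{u} A B) (Q : Profunctor.{u} B C) (a : A) (c : Cᵒᵖ) : Type u :=
  Quot (CoendRel P Q a c)

/-- The class of a pair `(p, q)` in the coend. -/
def pair {P : Profunctor.{u} A B} {Q : Profunctor.{u} B C} {a : A} {c : Cᵒᵖ} {b : B}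
    (p : (P.obj a).obj (op b)) (q : (Q.obj b).obj c) : CoendObj P Q a c :=
  Quot.mk _ ⟨b, p, q⟩

theorem pair_move {P : Profunctor.{u} A B} {Q : Profunctor.{u} B C} {a : A} {c : Cᵒᵖ} {b b' : B}
    (β : b ⟶ b') (p : (P.obj a).obj (op b')) (q : (Q.obj b).obj c) :
    (pair ((P.obj a).map β.op p) q : CoendObj P Q a c) = pair p ((Q.map β).app c q) :=
  Quot.sound (CoendRel.move β p q)

/-- A function out of the coend is a family of functions compatible with the moves. -/
def CoendObj.lift {P : Profunctor.{u} A B} {Q : Profunctor.{u} B C} {a : A} {c : Cᵒᵖ}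
    {X : Type u} (f : ∀ b : B, (P.obj a).obj (op b) → (Q.obj b).obj c → X)
    (hf : ∀ {b b' : B} (β : b ⟶ b') (p : (P.obj a).obj (op b')) (q : (Q.obj b).obj c),
      f b ((P.obj a).map β.op p) q = f b' p ((Q.map β).app c q)) :
    CoendObj P Q a c → X :=
  Quot.lift (fun t => f t.1 t.2.1 t.2.2) (by rintro _ _ ⟨β, p, q⟩; exact hf β p q)

theorem CoendObj.ind {P : Profunctor.{u} A B} {Q : Profunctor.{u} B C} {a : A} {c : Cᵒᵖ}
    {motive : CoendObj P Q a c → Prop}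
    (h : ∀ (b : B) (p : (P.obj a).obj (op b)) (q : (Q.obj b).obj c), motive (pair p q))
    (x : CoendObj P Q a c) : motive x :=
  Quot.ind (fun t => h t.1 t.2.1 t.2.2) x

/-- Constructor for natural transformations of profunctors from functions on elements. -/
def homMk {P Q : Profunctor.{u} A B}
    (f : ∀ (a : A) (b : Bᵒᵖ), (P.obj a).obj b → (Q.obj a).obj b)
    (hr : ∀ (a : A) {b b' : Bᵒᵖ} (β : b ⟶ b') (p : (P.obj a).obj b),
      f a b' ((P.obj a).map β p) = (Q.obj a).map β (f a b p))
    (hl : ∀ {a a' : A} (α : a ⟶ a') (b : Bᵒᵖ) (p : (P.obj a).obj b),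
      f a' b ((P.map α).app b p) = (Q.map α).app b (f a b p)) : P ⟶ Q where
  app a :=
    { app b := ↾(f a b)
      naturality b b' β := by ext p; exact hr a β p }
  naturality a a' α := by ext b p; exact hl α b p

theorem hom_ext {P Q : Profunctor.{u} A B} {f g : P ⟶ Q}
    (h : ∀ (a : A) (b : Bᵒᵖ) (p : (P.obj a).obj b), (f.app a).app b p = (g.app a).app b p) :
    f = g := by
  ext a b p
  exact h a b p

theorem nat_right {P Q : Profunctor.{u} A B} (f : P ⟶ Q) (a : A) {b b' : Bᵒᵖ} (β : b ⟶ b')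
    (p : (P.obj a).obj b) :
    (f.app a).app b' ((P.obj a).map β p) = (Q.obj a).map β ((f.app a).app b p) :=
  ConcreteCategory.congr_hom ((f.app a).naturality β) p

theorem nat_left {P Q : Profunctor.{u} A B} (f : P ⟶ Q) {a a' : A} (α : a ⟶ a') (b : Bᵒᵖ)
    (p : (P.obj a).obj b) :
    (f.app a').app b ((P.map α).app b p) = (Q.map α).app b ((f.app a).app b p) :=
  ConcreteCategory.congr_hom (NatTrans.congr_app (f.naturality α) b) p

theorem act_comm (P : Profunctor.{u} A B) {a a' : A} (α : a ⟶ a') {b b' : Bᵒᵖ} (β : b ⟶ b')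
    (p : (P.obj a).obj b) :
    (P.map α).app b' ((P.obj a).map β p) = (P.obj a').map β ((P.map α).app b p) :=
  ConcreteCategory.congr_hom ((P.map α).naturality β) p

theorem map_left_id (P : Profunctor.{u} A B) (a : A) (b : Bᵒᵖ) (p : (P.obj a).obj b) :
    (P.map (𝟙 a)).app b p = p := by simp

theorem map_right_id (P : Profunctor.{u} A B) (a : A) (b : Bᵒᵖ) (p : (P.obj a).obj b) :
    (P.obj a).map (𝟙 b) p = p := by simp

theorem map_left_comp (P : Profunctor.{u} A B) {a a' a'' : A} (α : a ⟶ a') (α' : a' ⟶ a'')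
    (b : Bᵒᵖ) (p : (P.obj a).obj b) :
    (P.map (α ≫ α')).app b p = (P.map α').app b ((P.map α).app b p) := by simp

theorem map_right_comp (P : Profunctor.{u} A B) (a : A) {b b' b'' : Bᵒᵖ} (β : b ⟶ b')
    (β' : b' ⟶ b'') (p : (P.obj a).obj b) :
    (P.obj a).map (β ≫ β') p = (P.obj a).map β' ((P.obj a).map β p) := by simp

/-- The composite profunctor `(a, c) ↦ ∫ b, P(a, b) × Q(b, c)`. -/
def compProf (P : Profunctor.{u} A B) (Q : Profunctor.{u} B C) : Profunctor.{u} A C where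
  obj a :=
    { obj c := CoendObj P Q a c
      map γ := ↾(CoendObj.lift (fun b p q => pair p ((Q.obj b).map γ q)) (by
        intro b b' β p q
        rw [pair_move, act_comm]))
      map_id c := by
        ext x
        induction x using CoendObj.ind with
        | h b p q => exact congrArg (pair p) (map_right_id Q b c q)
      map_comp γ γ' := by
        ext x
        induction x using CoendObj.ind with
        | h b p q => exact congrArg (pair p) (map_right_comp Q b γ γ' q) }
  map α :=
    { app c := ↾(CoendObj.lift (fun b p q => pair ((P.map α).app (op b) p) q) (by
        intro b b' β p q
        rw [act_comm, pair_move]))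
      naturality c c' γ := by
        ext x
        induction x using CoendObj.ind with
        | h b p q => rfl }
  map_id a := by
    ext c x
    induction x using CoendObj.ind with
    | h b p q => exact congrArg (fun t => pair t q) (map_left_id P a (op b) p)
  map_comp α α' := by
    ext c x
    induction x using CoendObj.ind with
    | h b p q => exact congrArg (fun t => pair t q) (map_left_comp P α α' (op b) p)

end Coend

/-- A 1-cell `A ⟶ B` is a profunctor `(a, b) ↦ P(a, b)`, covariant in `a : A` and contravariant
in `b : B`; the identity is the hom-profunctor and composition is by coends. -/
instance : CategoryStruct.{u + 1} Prof.{u} where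
  Hom A B := Profunctor.{u} A.carrier B.carrier
  id _ := Profunctor.id
  comp P Q := compProf P Q

/-- The 2-cells are the natural transformations. -/
instance homCat (A B : Prof.{u}) : Category.{u} (A ⟶ B) :=
  inferInstanceAs (Category.{u} (A.carrier ⥤ B.carrierᵒᵖ ⥤ Type u))

section TwoCells

variable {A B C D : Prof.{u}}

/-- Whiskering of a 2-cell by a profunctor on the left. -/
def whiskL (P : A ⟶ B) {Q Q' : B ⟶ C} (θ : Q ⟶ Q') : P ≫ Q ⟶ P ≫ Q' :=
  homMk (P := compProf P Q) (Q := compProf P Q')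
    (fun _ c => CoendObj.lift (fun b p q => pair p ((θ.app b).app c q)) (by
      intro b b' β p q
      rw [pair_move, nat_left]))
    (by
      intro a c c' γ x
      induction x using CoendObj.ind with
      | h b p q => exact congrArg (pair p) (nat_right θ b γ q))
    (by
      intro a a' α c x
      induction x using CoendObj.ind with
      | h b p q => rfl)

/-- Whiskering of a 2-cell by a profunctor on the right. -/
def whiskR {P P' : A ⟶ B} (θ : P ⟶ P') (Q : B ⟶ C) : P ≫ Q ⟶ P' ≫ Q :=
  homMk (P := compProf P Q) (Q := compProf P' Q)
    (fun a _ => CoendObj.lift (fun b p q => pair ((θ.app a).app (op b) p) q) (by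
      intro b b' β p q
      rw [nat_right, pair_move]))
    (by
      intro a c c' γ x
      induction x using CoendObj.ind with
      | h b p q => rfl)
    (by
      intro a a' α c x
      induction x using CoendObj.ind with
      | h b p q => exact congrArg (fun t => pair t q) (nat_left θ α (op b) p))

/-- The associator of profunctor composition, `((p, q), r) ↦ (p, (q, r))`. -/
def assocHom (P : A ⟶ B) (Q : B ⟶ C) (R : C ⟶ D) : (P ≫ Q) ≫ R ⟶ P ≫ (Q ≫ R) :=
  homMk (P := compProf (compProf P Q) R) (Q := compProf P (compProf Q R))
    (fun _ _ => CoendObj.lift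
      (fun _ x r => CoendObj.lift (fun _ p q => pair p (pair q r))
        (by intro b b' β p q; exact pair_move (Q := compProf Q R) β p (pair q r)) x)
      (by
        intro c c' γ x r
        induction x using CoendObj.ind with
        | h b p q => exact congrArg (pair p) (pair_move γ q r)))
    (by
      intro a d d' δ x
      induction x using CoendObj.ind with
      | h c y r =>
        induction y using CoendObj.ind with
        | h b p q => rfl)
    (by
      intro a a' α d x
      induction x using CoendObj.ind with
      | h c y r =>
        induction y using CoendObj.ind with
        | h b p q => rfl)

/-- The inverse associator of profunctor composition, `(p, (q, r)) ↦ ((p, q), r)`. -/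
def assocInv (P : A ⟶ B) (Q : B ⟶ C) (R : C ⟶ D) : P ≫ (Q ≫ R) ⟶ (P ≫ Q) ≫ R :=
  homMk (P := compProf P (compProf Q R)) (Q := compProf (compProf P Q) R)
    (fun _ _ => CoendObj.lift
      (fun _ p y => CoendObj.lift (fun _ q r => pair (pair p q) r)
        (by intro c c' γ q r; exact pair_move (P := compProf P Q) γ (pair p q) r) y)
      (by
        intro b b' β p y
        induction y using CoendObj.ind with
        | h c q r => exact congrArg (fun t => pair t r) (pair_move β p q)))
    (by
      intro a d d' δ x
      induction x using CoendObj.ind with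
      | h b p y =>
        induction y using CoendObj.ind with
        | h c q r => rfl)
    (by
      intro a a' α d x
      induction x using CoendObj.ind with
      | h b p y =>
        induction y using CoendObj.ind with
        | h c q r => rfl)

/-- The left unitor of profunctor composition, `(f, p) ↦ f · p`. -/
def leftUnitHom (P : A ⟶ B) : 𝟙 A ≫ P ⟶ P :=
  homMk (P := compProf Profunctor.id P) (Q := P)
    (fun _ b => CoendObj.lift (fun _ f p => (P.map f).app b p) (by
      intro a' a'' α f p
      exact map_left_comp P α f b p))
    (by
      intro a b b' β x
      induction x using CoendObj.ind with
      | h a' f p => exact act_comm P f β p)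
    (by
      intro a a' α b x
      induction x using CoendObj.ind with
      | h a'' f p => exact map_left_comp P f α b p)

/-- The right unitor of profunctor composition, `(p, f) ↦ p · f`. -/
def rightUnitHom (P : A ⟶ B) : P ≫ 𝟙 B ⟶ P :=
  homMk (P := compProf P Profunctor.id) (Q := P)
    (fun a _ => CoendObj.lift (fun _ p f => (P.obj a).map f.op p) (by
      intro b b' β p f
      exact (map_right_comp P a β.op f.op p).symm))
    (by
      intro a b b' β x
      induction x using CoendObj.ind with
      | h b'' p f => exact map_right_comp P a f.op β p)
    (by
      intro a a' α b x
      induction x using CoendObj.ind with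
      | h b'' p f => exact (act_comm P α f.op p).symm)

/-- The associator isomorphism of profunctor composition. -/
def assocIso (P : A ⟶ B) (Q : B ⟶ C) (R : C ⟶ D) : (P ≫ Q) ≫ R ≅ P ≫ (Q ≫ R) where
  hom := assocHom P Q R
  inv := assocInv P Q R
  hom_inv_id := hom_ext (by
    intro a d x
    induction x using CoendObj.ind with
    | h c y r =>
      induction y using CoendObj.ind with
      | h b p q => rfl)
  inv_hom_id := hom_ext (by
    intro a d x
    induction x using CoendObj.ind with
    | h b p y =>
      induction y using CoendObj.ind with
      | h c q r => rfl)

/-- The left unitor isomorphism; its inverse is `p ↦ (1, p)`. -/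
def leftUnitIso (P : A ⟶ B) : 𝟙 A ≫ P ≅ P where
  hom := leftUnitHom P
  inv := homMk (P := P) (Q := compProf Profunctor.id P)
    (fun a _ p => pair (P := Profunctor.id) (b := a) (𝟙 a) p)
    (by intro a b b' β p; rfl)
    (by
      intro a a' α b p
      refine (pair_move (P := Profunctor.id) α (𝟙 a') p).symm.trans ?_
      refine congrArg (fun t => pair (P := Profunctor.id) (Q := P) t p) ?_
      exact (Category.comp_id α).trans (Category.id_comp α).symm)
  hom_inv_id := hom_ext (by
    intro a b x
    induction x using CoendObj.ind with
    | h a' f p =>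
      refine (pair_move (P := Profunctor.id) f (𝟙 a) p).symm.trans ?_
      exact congrArg (fun t => pair (P := Profunctor.id) (Q := P) t p) (Category.comp_id f))
  inv_hom_id := hom_ext (by
    intro a b p
    exact map_left_id P a b p)

/-- The right unitor isomorphism; its inverse is `p ↦ (p, 1)`. -/
def rightUnitIso (P : A ⟶ B) : P ≫ 𝟙 B ≅ P where
  hom := rightUnitHom P
  inv := homMk (P := P) (Q := compProf P Profunctor.id)
    (fun _ b p => pair (Q := Profunctor.id) (b := b.unop) p (𝟙 b.unop))
    (by
      intro a b b' β p
      refine (pair_move (Q := Profunctor.id) β.unop p (𝟙 b'.unop)).trans ?_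
      refine congrArg (fun t => pair (P := P) (Q := Profunctor.id) p t) ?_
      exact (Category.id_comp β.unop).trans (Category.comp_id β.unop).symm)
    (by intro a a' α b p; rfl)
  hom_inv_id := hom_ext (by
    intro a b x
    induction x using CoendObj.ind with
    | h b' p f =>
      refine (pair_move (Q := Profunctor.id) f p (𝟙 b.unop)).trans ?_
      exact congrArg (fun t => pair (P := P) (Q := Profunctor.id) p t) (Category.id_comp f))
  inv_hom_id := hom_ext (by
    intro a b p
    exact map_right_id P a b p)

end TwoCells

/-- The bicategory of small categories, profunctors and natural transformations. -/
instance : Bicategory.{u, u + 1} Prof.{u} where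
  homCategory := inferInstance
  whiskerLeft P _ _ θ := whiskL P θ
  whiskerRight θ Q := whiskR θ Q
  associator := assocIso
  leftUnitor := leftUnitIso
  rightUnitor := rightUnitIso
  whiskerLeft_id P Q := hom_ext (by
    intro a c x
    induction x using CoendObj.ind with
    | h b p q => rfl)
  whiskerLeft_comp P _ _ _ θ κ := hom_ext (by
    intro a c x
    induction x using CoendObj.ind with
    | h b p q => rfl)
  id_whiskerLeft θ := by
    rw [← Category.assoc]
    refine (Iso.eq_comp_inv (leftUnitIso _)).2 (hom_ext ?_)
    intro a c x
    induction x using CoendObj.ind with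
    | h b f p => exact (nat_left θ f c p).symm
  comp_whiskerLeft P Q _ _ θ := hom_ext (by
    intro a c x
    induction x using CoendObj.ind with
    | h b y r =>
      induction y using CoendObj.ind with
      | h b' p q => rfl)
  id_whiskerRight P Q := hom_ext (by
    intro a c x
    induction x using CoendObj.ind with
    | h b p q => rfl)
  comp_whiskerRight θ κ Q := hom_ext (by
    intro a c x
    induction x using CoendObj.ind with
    | h b p q => rfl)
  whiskerRight_id θ := by
    rw [← Category.assoc]
    refine (Iso.eq_comp_inv (rightUnitIso _)).2 (hom_ext ?_)
    intro a c x
    induction x using CoendObj.ind with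
    | h b p f => exact (nat_right θ a f.op p).symm
  whiskerRight_comp θ Q R := hom_ext (by
    intro a c x
    induction x using CoendObj.ind with
    | h b p y =>
      induction y using CoendObj.ind with
      | h b' q r => rfl)
  whisker_assoc P _ _ θ R := hom_ext (by
    intro a c x
    induction x using CoendObj.ind with
    | h b y r =>
      induction y using CoendObj.ind with
      | h b' p q => rfl)
  whisker_exchange θ κ := hom_ext (by
    intro a c x
    induction x using CoendObj.ind with
    | h b p q => rfl)
  pentagon P Q R S := hom_ext (by
    intro a e x
    induction x using CoendObj.ind with
    | h d y s =>
      induction y using CoendObj.ind with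
      | h c z r =>
        induction z using CoendObj.ind with
        | h b p q => rfl)
  triangle P Q := hom_ext (by
    intro a c x
    induction x using CoendObj.ind with
    | h b y q =>
      induction y using CoendObj.ind with
      | h b' p f => exact (pair_move (P := P) (Q := Q) f p q).symm)

section Embeddings

variable {A B C D : Prof.{u}}

/-- The covariant embedding (representation) `(a, b) ↦ B(b, F a)` of a functor `F`. -/
def rep (F : A.carrier ⥤ B.carrier) : A ⟶ B := F.toProfunctor

/-- The contravariant embedding (corepresentation) `(b, a) ↦ B(F a, b)` of a functor `F`. -/
def corep (F : A.carrier ⥤ B.carrier) : B ⟶ A := F.toProfunctorRev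

/-- The unit of the adjunction `rep F ⊣ corep F`: it sends `f` to `F f`. -/
def repUnit (F : A.carrier ⥤ B.carrier) : 𝟙 A ⟶ rep F ≫ corep F :=
  homMk (P := Profunctor.id) (Q := compProf F.toProfunctor F.toProfunctorRev)
    (fun a _ f => pair (P := F.toProfunctor) (Q := F.toProfunctorRev) (b := F.obj a)
      (𝟙 (F.obj a)) (F.map f))
    (by
      intro a b b' β f
      exact congrArg (pair (P := F.toProfunctor) (Q := F.toProfunctorRev) (𝟙 (F.obj a)))
        (F.map_comp β.unop f))
    (by
      intro a a' α b f
      refine (congrArg (pair (P := F.toProfunctor) (Q := F.toProfunctorRev) (𝟙 (F.obj a')))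
        (F.map_comp f α)).trans ?_
      refine (pair_move (P := F.toProfunctor) (Q := F.toProfunctorRev) (F.map α)
        (𝟙 (F.obj a')) (F.map f)).symm.trans ?_
      refine congrArg (fun t => pair (P := F.toProfunctor) (Q := F.toProfunctorRev) t
        (F.map f)) ?_
      exact (Category.comp_id (F.map α)).trans (Category.id_comp (F.map α)).symm)

/-- The counit of the adjunction `rep F ⊣ corep F`: it composes morphisms,
sending `(f : F a ⟶ b', g : b ⟶ F a)` to `g ≫ f`. -/
def repCounit (F : A.carrier ⥤ B.carrier) : corep F ≫ rep F ⟶ 𝟙 B :=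
  homMk (P := compProf F.toProfunctorRev F.toProfunctor) (Q := Profunctor.id)
    (fun b' b => CoendObj.lift (P := F.toProfunctorRev) (Q := F.toProfunctor)
      (fun a (f : F.obj a ⟶ b') (g : b.unop ⟶ F.obj a) => (g ≫ f : b.unop ⟶ b'))
      (by
        intro a a' α f g
        exact (Category.assoc _ _ _).symm))
    (by
      intro a b b' β x
      induction x using CoendObj.ind with
      | h c f g => exact Category.assoc _ _ _)
    (by
      intro a a' α b x
      induction x using CoendObj.ind with
      | h c f g => exact (Category.assoc _ _ _).symm)

/-- A functor's representation is left adjoint to its corepresentation. -/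
def repAdj (F : A.carrier ⥤ B.carrier) : rep F ⊣ corep F where
  unit := repUnit F
  counit := repCounit F
  left_triangle := by
    refine (congrArg (fun t => repUnit F ▷ rep F ≫ t ≫ rep F ◁ repCounit F)
      (show BicategoricalCoherence.iso.hom = (α_ (rep F) (corep F) (rep F)).hom by
        simp [BicategoricalCoherence.iso])).trans (hom_ext ?_)
    intro a b x
    induction x using CoendObj.ind with
    | h a' f g =>
      refine (congrArg (fun t => pair (P := F.toProfunctor) (Q := Profunctor.id)
        (𝟙 (F.obj a)) t) (Category.id_comp (g ≫ F.map f)).symm).trans ?_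
      refine (pair_move (P := F.toProfunctor) (Q := Profunctor.id) (g ≫ F.map f)
        (𝟙 (F.obj a)) (𝟙 b.unop)).symm.trans ?_
      exact congrArg (fun t => pair (P := F.toProfunctor) (Q := Profunctor.id) t (𝟙 b.unop))
        (Category.comp_id (g ≫ F.map f))
  right_triangle := by
    refine (congrArg (fun t => corep F ◁ repUnit F ≫ t ≫ repCounit F ▷ corep F)
      (show BicategoricalCoherence.iso.hom = (α_ (corep F) (rep F) (corep F)).inv by
        simp [BicategoricalCoherence.iso])).trans (hom_ext ?_)
    intro b a x
    induction x using CoendObj.ind with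
    | h a' f g =>
      refine (congrArg (fun t => pair (P := Profunctor.id) (Q := F.toProfunctorRev)
        t (F.map g)) (Category.id_comp f)).trans ?_
      refine (congrArg (fun t => pair (P := Profunctor.id) (Q := F.toProfunctorRev)
        t (F.map g)) (Category.comp_id f).symm).trans ?_
      refine (pair_move (P := Profunctor.id) (Q := F.toProfunctorRev) f (𝟙 b)
        (F.map g)).trans ?_
      rfl

/-- The representation of an identity functor is an identity 1-cell. -/
def repId (A : Prof.{u}) : rep (A := A) (B := A) (𝟭 A.carrier) ≅ 𝟙 A where
  hom := homMk (P := (𝟭 A.carrier).toProfunctor) (Q := Profunctor.id) (fun _ _ f => f)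
    (fun _ _ _ _ _ => rfl) (fun _ _ _ => rfl)
  inv := homMk (P := Profunctor.id) (Q := (𝟭 A.carrier).toProfunctor) (fun _ _ f => f)
    (fun _ _ _ _ _ => rfl) (fun _ _ _ => rfl)
  hom_inv_id := rfl
  inv_hom_id := rfl

/-- The corepresentation of an identity functor is an identity 1-cell. -/
def corepId (A : Prof.{u}) : corep (A := A) (B := A) (𝟭 A.carrier) ≅ 𝟙 A where
  hom := homMk (P := (𝟭 A.carrier).toProfunctorRev) (Q := Profunctor.id) (fun _ _ f => f)
    (fun _ _ _ _ _ => rfl) (fun _ _ _ => rfl)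
  inv := homMk (P := Profunctor.id) (Q := (𝟭 A.carrier).toProfunctorRev) (fun _ _ f => f)
    (fun _ _ _ _ _ => rfl) (fun _ _ _ => rfl)
  hom_inv_id := rfl
  inv_hom_id := rfl

/-- Representations compose: `(f, g) ↦ g ≫ G f`. -/
def repComp (F : A.carrier ⥤ B.carrier) (G : B.carrier ⥤ C.carrier) :
    rep F ≫ rep G ≅ rep (A := A) (B := C) (F ⋙ G) where
  hom := homMk (P := compProf F.toProfunctor G.toProfunctor) (Q := (F ⋙ G).toProfunctor)
    (fun a c => CoendObj.lift (P := F.toProfunctor) (Q := G.toProfunctor)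
      (fun b (f : b ⟶ F.obj a) (g : c.unop ⟶ G.obj b) =>
        (g ≫ G.map f : c.unop ⟶ G.obj (F.obj a)))
      (by
        intro b b' β f g
        exact ((congrArg (fun t => g ≫ t) (G.map_comp β f)).trans
          (Category.assoc _ _ _).symm)))
    (by
      intro a c c' γ x
      induction x using CoendObj.ind with
      | h b f g => exact Category.assoc _ _ _)
    (by
      intro a a' α c x
      induction x using CoendObj.ind with
      | h b f g =>
        exact (congrArg (fun t => g ≫ t) (G.map_comp f (F.map α))).trans
          (Category.assoc _ _ _).symm)
  inv := homMk (P := (F ⋙ G).toProfunctor) (Q := compProf F.toProfunctor G.toProfunctor)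
    (fun a _ h => pair (P := F.toProfunctor) (Q := G.toProfunctor) (b := F.obj a)
      (𝟙 (F.obj a)) h)
    (by intro a c c' γ h; rfl)
    (by
      intro a a' α c h
      refine (pair_move (P := F.toProfunctor) (Q := G.toProfunctor) (F.map α)
        (𝟙 (F.obj a')) h).symm.trans ?_
      refine congrArg (fun t => pair (P := F.toProfunctor) (Q := G.toProfunctor) t h) ?_
      exact (Category.comp_id (F.map α)).trans (Category.id_comp (F.map α)).symm)
  hom_inv_id := hom_ext (by
    intro a c x
    induction x using CoendObj.ind with
    | h b f g =>
      refine (pair_move (P := F.toProfunctor) (Q := G.toProfunctor) f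
        (𝟙 (F.obj a)) g).symm.trans ?_
      exact congrArg (fun t => pair (P := F.toProfunctor) (Q := G.toProfunctor) t g)
        (Category.comp_id f))
  inv_hom_id := hom_ext (by
    intro a c h
    exact (congrArg (fun t => h ≫ t) (G.map_id (F.obj a))).trans (Category.comp_id h))

/-- Corepresentations compose contravariantly: `(g, f) ↦ G f ≫ g`. -/
def corepComp (F : A.carrier ⥤ B.carrier) (G : B.carrier ⥤ C.carrier) :
    corep G ≫ corep F ≅ corep (A := A) (B := C) (F ⋙ G) where
  hom := homMk (P := compProf G.toProfunctorRev F.toProfunctorRev)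
    (Q := (F ⋙ G).toProfunctorRev)
    (fun c a => CoendObj.lift (P := G.toProfunctorRev) (Q := F.toProfunctorRev)
      (fun b (g : G.obj b ⟶ c) (f : F.obj a.unop ⟶ b) =>
        (G.map f ≫ g : G.obj (F.obj a.unop) ⟶ c))
      (by
        intro b b' β g f
        exact ((congrArg (fun t => t ≫ g) (G.map_comp f β)).trans
          (Category.assoc _ _ _)).symm))
    (by
      intro c a a' α x
      induction x using CoendObj.ind with
      | h b g f =>
        exact (congrArg (fun t => t ≫ g) (G.map_comp (F.map α.unop) f)).trans
          (Category.assoc _ _ _))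
    (by
      intro c c' γ a x
      induction x using CoendObj.ind with
      | h b g f => exact (Category.assoc _ _ _).symm)
  inv := homMk (P := (F ⋙ G).toProfunctorRev)
    (Q := compProf G.toProfunctorRev F.toProfunctorRev)
    (fun _ a h => pair (P := G.toProfunctorRev) (Q := F.toProfunctorRev)
      (b := F.obj a.unop) h (𝟙 (F.obj a.unop)))
    (by
      intro c a a' α h
      refine (pair_move (P := G.toProfunctorRev) (Q := F.toProfunctorRev) (F.map α.unop)
        h (𝟙 (F.obj a'.unop))).trans ?_
      refine congrArg (fun t => pair (P := G.toProfunctorRev) (Q := F.toProfunctorRev) h t) ?_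
      exact (Category.id_comp (F.map α.unop)).trans (Category.comp_id (F.map α.unop)).symm)
    (by intro c c' γ a h; rfl)
  hom_inv_id := hom_ext (by
    intro c a x
    induction x using CoendObj.ind with
    | h b g f =>
      refine (pair_move (P := G.toProfunctorRev) (Q := F.toProfunctorRev) f
        g (𝟙 (F.obj a.unop))).trans ?_
      exact congrArg (fun t => pair (P := G.toProfunctorRev) (Q := F.toProfunctorRev) g t)
        (Category.id_comp f))
  inv_hom_id := hom_ext (by
    intro c a h
    exact (congrArg (fun t => t ≫ h) (G.map_id (F.obj a.unop))).trans (Category.id_comp h))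

/-- A natural isomorphism `φ : F ≅ G` acts on representations by post-composition with `φ`. -/
def repMap {F G : A.carrier ⥤ B.carrier} (φ : F ≅ G) :
    (rep F : A ⟶ B) ≅ rep G where
  hom := homMk (P := F.toProfunctor) (Q := G.toProfunctor)
    (fun a b (f : b.unop ⟶ F.obj a) => (f ≫ φ.hom.app a : b.unop ⟶ G.obj a))
    (by intro a b b' β f; exact Category.assoc _ _ _)
    (by
      intro a a' α b f
      exact (Category.assoc _ _ _).trans ((congrArg (fun t => f ≫ t)
        (φ.hom.naturality α)).trans (Category.assoc _ _ _).symm))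
  inv := homMk (P := G.toProfunctor) (Q := F.toProfunctor)
    (fun a b (f : b.unop ⟶ G.obj a) => (f ≫ φ.inv.app a : b.unop ⟶ F.obj a))
    (by intro a b b' β f; exact Category.assoc _ _ _)
    (by
      intro a a' α b f
      exact (Category.assoc _ _ _).trans ((congrArg (fun t => f ≫ t)
        (φ.inv.naturality α)).trans (Category.assoc _ _ _).symm))
  hom_inv_id := hom_ext (by
    intro a b f
    exact (Category.assoc _ _ _).trans ((congrArg (fun t => f ≫ t)
      (φ.hom_inv_id_app a)).trans (Category.comp_id f)))
  inv_hom_id := hom_ext (by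
    intro a b f
    exact (Category.assoc _ _ _).trans ((congrArg (fun t => f ≫ t)
      (φ.inv_hom_id_app a)).trans (Category.comp_id f)))

/-- A natural isomorphism `φ : F ≅ G` acts on corepresentations by pre-composition with the
inverse of `φ`. -/
def corepMap {F G : A.carrier ⥤ B.carrier} (φ : F ≅ G) :
    (corep F : B ⟶ A) ≅ corep G where
  hom := homMk (P := F.toProfunctorRev) (Q := G.toProfunctorRev)
    (fun b a (f : F.obj a.unop ⟶ b) => (φ.inv.app a.unop ≫ f : G.obj a.unop ⟶ b))
    (by
      intro b a a' α f
      exact (Category.assoc _ _ _).symm.trans ((congrArg (fun t => t ≫ f)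
        (φ.inv.naturality α.unop).symm).trans (Category.assoc _ _ _)))
    (by intro b b' β a f; exact (Category.assoc _ _ _).symm)
  inv := homMk (P := G.toProfunctorRev) (Q := F.toProfunctorRev)
    (fun b a (f : G.obj a.unop ⟶ b) => (φ.hom.app a.unop ≫ f : F.obj a.unop ⟶ b))
    (by
      intro b a a' α f
      exact (Category.assoc _ _ _).symm.trans ((congrArg (fun t => t ≫ f)
        (φ.hom.naturality α.unop).symm).trans (Category.assoc _ _ _)))
    (by intro b b' β a f; exact (Category.assoc _ _ _).symm)
  hom_inv_id := hom_ext (by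
    intro b a f
    exact (Category.assoc _ _ _).symm.trans ((congrArg (fun t => t ≫ f)
      (φ.hom_inv_id_app a.unop)).trans (Category.id_comp f)))
  inv_hom_id := hom_ext (by
    intro b a f
    exact (Category.assoc _ _ _).symm.trans ((congrArg (fun t => t ≫ f)
      (φ.inv_hom_id_app a.unop)).trans (Category.id_comp f)))

end Embeddings

section Product

variable {A A' B B' C C' : Prof.{u}}

/-- The monoidal product of 0-cells: the product of categories. -/
abbrev box (A B : Prof.{u}) : Prof.{u} := Prof.of (A.carrier × B.carrier)

/-- The monoidal unit: the terminal category. -/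
abbrev pt : Prof.{u} := Prof.of (Discrete PUnit.{u + 1})

/-- The profunctor `((a, a'), (b, b')) ↦ P(a, b) × P'(a', b')`. -/
def boxProf {A A' B B' : Type u} [SmallCategory A] [SmallCategory A'] [SmallCategory B]
    [SmallCategory B'] (P : Profunctor.{u} A B) (P' : Profunctor.{u} A' B') :
    Profunctor.{u} (A × A') (B × B') where
  obj a :=
    { obj b := (P.obj a.1).obj (op b.unop.1) × (P'.obj a.2).obj (op b.unop.2)
      map β := ↾fun p =>
        ((P.obj a.1).map β.unop.1.op p.1, (P'.obj a.2).map β.unop.2.op p.2)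
      map_id b := by
        refine ConcreteCategory.hom_ext _ _ fun p => ?_
        exact Prod.ext (map_right_id P a.1 _ p.1) (map_right_id P' a.2 _ p.2)
      map_comp β β' := by
        refine ConcreteCategory.hom_ext _ _ fun p => ?_
        exact Prod.ext (map_right_comp P a.1 β.unop.1.op β'.unop.1.op p.1)
          (map_right_comp P' a.2 β.unop.2.op β'.unop.2.op p.2) }
  map α :=
    { app b := ↾fun p => ((P.map α.1).app _ p.1, (P'.map α.2).app _ p.2)
      naturality b b' β := by
        refine ConcreteCategory.hom_ext _ _ fun p => ?_
        exact Prod.ext (act_comm P α.1 β.unop.1.op p.1) (act_comm P' α.2 β.unop.2.op p.2) }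
  map_id a := by
    refine NatTrans.ext (funext fun b => ConcreteCategory.hom_ext _ _ fun p => ?_)
    exact Prod.ext (map_left_id P a.1 _ p.1) (map_left_id P' a.2 _ p.2)
  map_comp α α' := by
    refine NatTrans.ext (funext fun b => ConcreteCategory.hom_ext _ _ fun p => ?_)
    exact Prod.ext (map_left_comp P α.1 α'.1 _ p.1) (map_left_comp P' α.2 α'.2 _ p.2)

/-- The monoidal product of 1-cells. -/
def boxMap (P : A ⟶ B) (P' : A' ⟶ B') : box A A' ⟶ box B B' := boxProf P P'

/-- The monoidal product of 1-cells. -/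
infixr:85 " ⊠₁ " => boxMap

/-- The monoidal product of 2-cells. -/
def boxHom {P Q : A ⟶ B} {P' Q' : A' ⟶ B'} (θ : P ⟶ Q) (θ' : P' ⟶ Q') :
    P ⊠₁ P' ⟶ Q ⊠₁ Q' :=
  homMk (P := boxProf P P') (Q := boxProf Q Q')
    (fun a _ p => ((θ.app a.1).app _ p.1, (θ'.app a.2).app _ p.2))
    (by
      intro a b b' β p
      exact Prod.ext (nat_right θ a.1 β.unop.1.op p.1) (nat_right θ' a.2 β.unop.2.op p.2))
    (by
      intro a a' α b p
      exact Prod.ext (nat_left θ α.1 _ p.1) (nat_left θ' α.2 _ p.2))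

/-- The monoidal product of 2-cells. -/
infixr:85 " ⊠₂ " => boxHom

/-- The monoidal product of invertible 2-cells. -/
def boxIso {P Q : A ⟶ B} {P' Q' : A' ⟶ B'} (θ : P ≅ Q) (θ' : P' ≅ Q') :
    P ⊠₁ P' ≅ Q ⊠₁ Q' where
  hom := θ.hom ⊠₂ θ'.hom
  inv := θ.inv ⊠₂ θ'.inv
  hom_inv_id := hom_ext (by
    intro a b p
    have h := congrArg (fun t => (t.app a.1).app (op b.unop.1) p.1) θ.hom_inv_id
    have h' := congrArg (fun t => (t.app a.2).app (op b.unop.2) p.2) θ'.hom_inv_id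
    exact Prod.ext h h')
  inv_hom_id := hom_ext (by
    intro a b p
    have h := congrArg (fun t => (t.app a.1).app (op b.unop.1) p.1) θ.inv_hom_id
    have h' := congrArg (fun t => (t.app a.2).app (op b.unop.2) p.2) θ'.inv_hom_id
    exact Prod.ext h h')

/-- The product of identity 1-cells is an identity 1-cell. -/
def boxId (A A' : Prof.{u}) : 𝟙 A ⊠₁ 𝟙 A' ≅ 𝟙 (box A A') where
  hom := homMk (P := boxProf Profunctor.id Profunctor.id) (Q := Profunctor.id)
    (fun _ _ f => f) (fun _ _ _ _ _ => rfl) (fun _ _ _ => rfl)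
  inv := homMk (P := Profunctor.id) (Q := boxProf Profunctor.id Profunctor.id)
    (fun _ _ f => f) (fun _ _ _ _ _ => rfl) (fun _ _ _ => rfl)
  hom_inv_id := rfl
  inv_hom_id := rfl

/-- The interchange of the monoidal product and composition,
`((p, p'), (q, q')) ↦ ((p, q), (p', q'))`. -/
def boxComp (P : A ⟶ B) (Q : B ⟶ C) (P' : A' ⟶ B') (Q' : B' ⟶ C') :
    (P ⊠₁ P') ≫ (Q ⊠₁ Q') ≅ (P ≫ Q) ⊠₁ (P' ≫ Q') where
  hom := homMk (P := compProf (boxProf P P') (boxProf Q Q'))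
    (Q := boxProf (compProf P Q) (compProf P' Q'))
    (fun a c => CoendObj.lift (P := boxProf P P') (Q := boxProf Q Q')
      (fun _ p q => (pair p.1 q.1, pair p.2 q.2))
      (by
        intro b b' β p q
        exact Prod.ext (pair_move β.1 p.1 q.1) (pair_move β.2 p.2 q.2)))
    (by
      intro a c c' γ x
      induction x using CoendObj.ind with
      | h b p q => rfl)
    (by
      intro a a' α c x
      induction x using CoendObj.ind with
      | h b p q => rfl)
  inv := homMk (P := boxProf (compProf P Q) (compProf P' Q'))
    (Q := compProf (boxProf P P') (boxProf Q Q'))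
    (fun a c x => CoendObj.lift
      (fun b p q => CoendObj.lift
        (fun b' p' q' => pair (P := boxProf P P') (Q := boxProf Q Q')
          (a := a) (c := c) (b := (b, b')) (p, p') (q, q'))
        (by
          intro b₁ b₂ β p' q'
          have h := pair_move (P := boxProf P P') (Q := boxProf Q Q') (a := a) (c := c)
            (b := (b, b₁)) (b' := (b, b₂)) (𝟙 b, β) (p, p') (q, q')
          have e₁ := map_right_id P a.1 (op b) p
          have e₂ := map_left_id Q b (op c.unop.1) q
          exact (congrArg (fun t => pair (P := boxProf P P') (Q := boxProf Q Q') (a := a)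
            (c := c) (b := (b, b₁)) (t, (P'.obj a.2).map β.op p') (q, q')) e₁.symm).trans
            (h.trans (congrArg (fun t => pair (P := boxProf P P') (Q := boxProf Q Q') (a := a)
            (c := c) (b := (b, b₂)) (p, p') (t, (Q'.map β).app _ q')) e₂)))
        x.2)
      (by
        intro b₁ b₂ β p q
        generalize x.2 = y
        induction y using CoendObj.ind with
        | h b' p' q' =>
          have h := pair_move (P := boxProf P P') (Q := boxProf Q Q') (a := a) (c := c)
            (b := (b₁, b')) (b' := (b₂, b')) (β, 𝟙 b') (p, p') (q, q')
          have e₁ := map_right_id P' a.2 (op b') p'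
          have e₂ := map_left_id Q' b' (op c.unop.2) q'
          exact (congrArg (fun t => pair (P := boxProf P P') (Q := boxProf Q Q') (a := a)
            (c := c) (b := (b₁, b')) ((P.obj a.1).map β.op p, t) (q, q')) e₁.symm).trans
            (h.trans (congrArg (fun t => pair (P := boxProf P P') (Q := boxProf Q Q') (a := a)
            (c := c) (b := (b₂, b')) (p, p') ((Q.map β).app _ q, t)) e₂)))
      x.1)
    (by
      intro a c c' γ x
      obtain ⟨x, y⟩ := x
      induction x using CoendObj.ind with
      | h b p q =>
        induction y using CoendObj.ind with
        | h b' p' q' => rfl)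
    (by
      intro a a' α c x
      obtain ⟨x, y⟩ := x
      induction x using CoendObj.ind with
      | h b p q =>
        induction y using CoendObj.ind with
        | h b' p' q' => rfl)
  hom_inv_id := hom_ext (by
    intro a c x
    induction x using CoendObj.ind with
    | h b p q => rfl)
  inv_hom_id := hom_ext (by
    intro a c x
    obtain ⟨x, y⟩ := x
    induction x using CoendObj.ind with
    | h b p q =>
      induction y using CoendObj.ind with
      | h b' p' q' => rfl)

/-- The product of representations is the representation of the product functor. -/
def repProd (F : A.carrier ⥤ B.carrier) (F' : A'.carrier ⥤ B'.carrier) :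
    rep F ⊠₁ rep F' ≅ rep (A := box A A') (B := box B B') (F.prod F') where
  hom := homMk (P := boxProf F.toProfunctor F'.toProfunctor) (Q := (F.prod F').toProfunctor)
    (fun _ _ f => f) (fun _ _ _ _ _ => rfl) (fun _ _ _ => rfl)
  inv := homMk (P := (F.prod F').toProfunctor) (Q := boxProf F.toProfunctor F'.toProfunctor)
    (fun _ _ f => f) (fun _ _ _ _ _ => rfl) (fun _ _ _ => rfl)
  hom_inv_id := rfl
  inv_hom_id := rfl

/-- The product of corepresentations is the corepresentation of the product functor. -/
def corepProd (F : A.carrier ⥤ B.carrier) (F' : A'.carrier ⥤ B'.carrier) :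
    corep F ⊠₁ corep F' ≅ corep (A := box A A') (B := box B B') (F.prod F') where
  hom := homMk (P := boxProf F.toProfunctorRev F'.toProfunctorRev)
    (Q := (F.prod F').toProfunctorRev)
    (fun _ _ f => f) (fun _ _ _ _ _ => rfl) (fun _ _ _ => rfl)
  inv := homMk (P := (F.prod F').toProfunctorRev)
    (Q := boxProf F.toProfunctorRev F'.toProfunctorRev)
    (fun _ _ f => f) (fun _ _ _ _ _ => rfl) (fun _ _ _ => rfl)
  hom_inv_id := rfl
  inv_hom_id := rfl

end Product

/-! ### The right-adjoint pseudomonoid in `Prof` given by a monoidal category -/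

section Pseudomonoid

variable (C : Type u) [SmallCategory C] [MonoidalCategory C]

open MonoidalCategory

/-- The unit object, as a functor from the terminal category. -/
abbrev unitFunctor : Discrete PUnit.{u + 1} ⥤ C := Functor.fromPUnit (𝟙_ C)

/-- Multiplication: the representation of `⊗`, with values `C(c, x ⊗ y)`. -/
def mul : box (of C) (of C) ⟶ of C := rep (A := box (of C) (of C)) (B := of C) (tensor C)

/-- Comultiplication: the corepresentation of `⊗`, with values `C(x ⊗ y, c)`. -/
def comul : of C ⟶ box (of C) (of C) := corep (A := box (of C) (of C)) (B := of C) (tensor C)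

/-- The unit: the representation of `I`, with values `C(c, I)`. -/
def one : pt.{u} ⟶ of C := rep (A := pt) (B := of C) (unitFunctor C)

/-- The counit: the corepresentation of `I`, with values `C(I, c)`. -/
def coone : of C ⟶ pt.{u} := corep (A := pt) (B := of C) (unitFunctor C)

/-- The adjunction `mul ⊣ comul`. -/
def mulAdj : mul C ⊣ comul C := repAdj (A := box (of C) (of C)) (B := of C) (tensor C)

/-- The adjunction `one ⊣ coone`. -/
def oneAdj : one C ⊣ coone C := repAdj (A := pt) (B := of C) (unitFunctor C)

/-- The rebracketing functor `(x, (y, z)) ↦ ((x, y), z)`. -/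
abbrev rebracket : C × (C × C) ⥤ (C × C) × C := prod.inverseAssociator C C C

/-- Forgetting the terminal category, `(x, *) ↦ x`. -/
abbrev dropUnit : C × Discrete PUnit.{u + 1} ⥤ C := CategoryTheory.Prod.fst _ _

/-- The inverse associators `x ⊗ (y ⊗ z) ≅ (x ⊗ y) ⊗ z` as a natural isomorphism. -/
def assocNatIso : (𝟭 C).prod (tensor C) ⋙ tensor C ≅
    rebracket C ⋙ (tensor C).prod (𝟭 C) ⋙ tensor C :=
  NatIso.ofComponents (fun X => (α_ X.1 X.2.1 X.2.2).symm)
    (fun f => associator_inv_naturality f.1 f.2.1 f.2.2)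

/-- The right unitors `x ⊗ I ≅ x` as a natural isomorphism. -/
def unitNatIso : (𝟭 C).prod (unitFunctor C) ⋙ tensor C ≅ dropUnit C :=
  NatIso.ofComponents (fun X => ρ_ X.1) (fun f => by
    have h := rightUnitor_naturality f.1
    rw [← tensorHom_id] at h
    exact h)

end Pseudomonoid

section Coherence

/-- The profunctor `id ⊠ rep F` is the representation of `id × F`. -/
def idBoxRep {A B : Prof.{u}} (D : Prof.{u}) (F : A.carrier ⥤ B.carrier) :
    𝟙 D ⊠₁ rep F ≅ rep (A := box D A) (B := box D B) ((𝟭 D.carrier).prod F) :=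
  boxIso (repId D).symm (Iso.refl _) ≪≫ repProd (A := D) (B := D) (𝟭 D.carrier) F

/-- The profunctor `rep F ⊠ id` is the representation of `F × id`. -/
def repBoxId {A B : Prof.{u}} (F : A.carrier ⥤ B.carrier) (D : Prof.{u}) :
    rep F ⊠₁ 𝟙 D ≅ rep (A := box A D) (B := box B D) (F.prod (𝟭 D.carrier)) :=
  boxIso (Iso.refl _) (repId D).symm ≪≫ repProd (A' := D) (B' := D) F (𝟭 D.carrier)

/-- The profunctor `id ⊠ corep F` is the corepresentation of `id × F`. -/
def idBoxCorep {A B : Prof.{u}} (D : Prof.{u}) (F : A.carrier ⥤ B.carrier) :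
    𝟙 D ⊠₁ corep F ≅ corep (A := box D A) (B := box D B) ((𝟭 D.carrier).prod F) :=
  boxIso (corepId D).symm (Iso.refl _) ≪≫ corepProd (A := D) (B := D) (𝟭 D.carrier) F

/-- The profunctor `corep F ⊠ id` is the corepresentation of `F × id`. -/
def corepBoxId {A B : Prof.{u}} (F : A.carrier ⥤ B.carrier) (D : Prof.{u}) :
    corep F ⊠₁ 𝟙 D ≅ corep (A := box A D) (B := box B D) (F.prod (𝟭 D.carrier)) :=
  boxIso (Iso.refl _) (corepId D).symm ≪≫ corepProd (A' := D) (B' := D) F (𝟭 D.carrier)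

/-- Apply a 2-cell `θ : P ≫ Q ⟶ 𝟙` on the right-hand wire of a pair of wires. -/
def onRight {A B D : Prof.{u}} {P : A ⟶ B} {Q : B ⟶ A} (θ : P ≫ Q ⟶ 𝟙 A) :
    (𝟙 D ⊠₁ P) ≫ (𝟙 D ⊠₁ Q) ⟶ 𝟙 (box D A) :=
  (boxComp (𝟙 D) (𝟙 D) P Q).hom ≫ ((λ_ (𝟙 D)).hom ⊠₂ θ) ≫ (boxId D A).hom

/-- Apply a 2-cell `θ : P ≫ Q ⟶ 𝟙` on the left-hand wire of a pair of wires. -/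
def onLeft {A B D : Prof.{u}} {P : A ⟶ B} {Q : B ⟶ A} (θ : P ≫ Q ⟶ 𝟙 A) :
    (P ⊠₁ 𝟙 D) ≫ (Q ⊠₁ 𝟙 D) ⟶ 𝟙 (box A D) :=
  (boxComp P Q (𝟙 D) (𝟙 D)).hom ≫ (θ ⊠₂ (λ_ (𝟙 D)).hom) ≫ (boxId A D).hom

end Coherence

section NearlyTracing

variable (C : Type u) [SmallCategory C] [MonoidalCategory C]

open MonoidalCategory (tensor)

/-- The 1-cell represented by `(x, (y, z)) ↦ ((x, y), z)`. -/
def reb : box (of C) (box (of C) (of C)) ⟶ box (box (of C) (of C)) (of C) :=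
  rep (A := box (of C) (box (of C) (of C))) (B := box (box (of C) (of C)) (of C)) (rebracket C)

/-- The 1-cell corepresented by `(x, (y, z)) ↦ ((x, y), z)`. -/
def coreb : box (box (of C) (of C)) (of C) ⟶ box (of C) (box (of C) (of C)) :=
  corep (A := box (of C) (box (of C) (of C))) (B := box (box (of C) (of C)) (of C)) (rebracket C)

/-- The adjunction `reb ⊣ coreb`. -/
def rebAdj : reb C ⊣ coreb C :=
  repAdj (A := box (of C) (box (of C) (of C))) (B := box (box (of C) (of C)) (of C)) (rebracket C)

/-- The 1-cell represented by `(x, *) ↦ x`. -/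
def drop : box (of C) pt.{u} ⟶ of C := rep (A := box (of C) pt) (B := of C) (dropUnit C)

/-- The 1-cell corepresented by `(x, *) ↦ x`. -/
def codrop : of C ⟶ box (of C) pt.{u} := corep (A := box (of C) pt) (B := of C) (dropUnit C)

/-- The adjunction `drop ⊣ codrop`. -/
def dropAdj : drop C ⊣ codrop C := repAdj (A := box (of C) pt) (B := of C) (dropUnit C)

/-- The associator 2-cell of the pseudomonoid: post-composition
`C(c, x ⊗ (y ⊗ z)) ≅ C(c, (x ⊗ y) ⊗ z)` with the inverse associator of `C`. -/
def mulAssoc : (𝟙 (of C) ⊠₁ mul C) ≫ mul C ≅ reb C ≫ (mul C ⊠₁ 𝟙 (of C)) ≫ mul C :=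
  whiskerRightIso (idBoxRep (A := box (of C) (of C)) (B := of C) (of C) (tensor C)) (mul C) ≪≫
  repComp (A := box (of C) (box (of C) (of C))) (B := box (of C) (of C)) (C := of C)
    ((𝟭 C).prod (tensor C)) (tensor C) ≪≫
  repMap (A := box (of C) (box (of C) (of C))) (B := of C) (assocNatIso C) ≪≫
  (repComp (A := box (of C) (box (of C) (of C))) (B := box (box (of C) (of C)) (of C))
    (C := of C) (rebracket C) ((tensor C).prod (𝟭 C) ⋙ tensor C)).symm ≪≫
  whiskerLeftIso (reb C) (repComp (A := box (box (of C) (of C)) (of C))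
    (B := box (of C) (of C)) (C := of C) ((tensor C).prod (𝟭 C)) (tensor C)).symm ≪≫
  whiskerLeftIso (reb C) (whiskerRightIso
    (repBoxId (A := box (of C) (of C)) (B := of C) (tensor C) (of C)).symm (mul C))

/-- The adjoint mate of the associator 2-cell: pre-composition
`C(x ⊗ (y ⊗ z), c) ≅ C((x ⊗ y) ⊗ z, c)` with the associator of `C`. -/
def comulAssoc : comul C ≫ (𝟙 (of C) ⊠₁ comul C) ≅
    (comul C ≫ (comul C ⊠₁ 𝟙 (of C))) ≫ coreb C :=
  whiskerLeftIso (comul C) (idBoxCorep (A := box (of C) (of C)) (B := of C) (of C) (tensor C)) ≪≫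
  corepComp (A := box (of C) (box (of C) (of C))) (B := box (of C) (of C)) (C := of C)
    ((𝟭 C).prod (tensor C)) (tensor C) ≪≫
  corepMap (A := box (of C) (box (of C) (of C))) (B := of C) (assocNatIso C) ≪≫
  (corepComp (A := box (of C) (box (of C) (of C))) (B := box (box (of C) (of C)) (of C))
    (C := of C) (rebracket C) ((tensor C).prod (𝟭 C) ⋙ tensor C)).symm ≪≫
  whiskerRightIso (corepComp (A := box (box (of C) (of C)) (of C))
    (B := box (of C) (of C)) (C := of C) ((tensor C).prod (𝟭 C)) (tensor C)).symm (coreb C) ≪≫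
  whiskerRightIso (whiskerLeftIso (comul C)
    (corepBoxId (A := box (of C) (of C)) (B := of C) (tensor C) (of C)).symm) (coreb C)

/-- The right unitor 2-cell of the pseudomonoid: post-composition `C(c, x ⊗ I) ≅ C(c, x)` with
the right unitor of `C`. -/
def mulUnit : (𝟙 (of C) ⊠₁ one C) ≫ mul C ≅ drop C :=
  whiskerRightIso (idBoxRep (A := pt) (B := of C) (of C) (unitFunctor C)) (mul C) ≪≫
  repComp (A := box (of C) pt) (B := box (of C) (of C)) (C := of C)
    ((𝟭 C).prod (unitFunctor C)) (tensor C) ≪≫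
  repMap (A := box (of C) pt) (B := of C) (unitNatIso C)

/-- The adjoint mate of the right unitor 2-cell: pre-composition `C(x ⊗ I, c) ≅ C(x, c)` with
the inverse right unitor of `C`. -/
def comulUnit : comul C ≫ (𝟙 (of C) ⊠₁ coone C) ≅ codrop C :=
  whiskerLeftIso (comul C) (idBoxCorep (A := pt) (B := of C) (of C) (unitFunctor C)) ≪≫
  corepComp (A := box (of C) pt) (B := box (of C) (of C)) (C := of C)
    ((𝟭 C).prod (unitFunctor C)) (tensor C) ≪≫
  corepMap (A := box (of C) pt) (B := of C) (unitNatIso C)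

/-- The nearly tracing 2-cell: the counit of the adjunction `mul ⊣ comul`. On elements it is the
composition of morphisms `∫ x y, C(x ⊗ y, a) × C(b, x ⊗ y) ⟶ C(b, a)`. Its being a 2-cell of
`Prof` contains the naturality in `a`, `b` and the dinaturality in `x`, `y`. -/
def nTr : comul C ≫ mul C ⟶ 𝟙 (of C) := (mulAdj C).counit

/-- The two bracketings of the doubled bubble: the associator and its mate rebracket
`x ⊗ (y ⊗ z)` as `(x ⊗ y) ⊗ z` on both sides. -/
def rebubble : (comul C ≫ (𝟙 (of C) ⊠₁ comul C)) ≫ ((𝟙 (of C) ⊠₁ mul C) ≫ mul C) ⟶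
    comul C ≫ ((comul C ⊠₁ 𝟙 (of C)) ≫ (mul C ⊠₁ 𝟙 (of C))) ≫ mul C :=
  (comulAssoc C).hom ▷ ((𝟙 (of C) ⊠₁ mul C) ≫ mul C) ≫
    ((comul C ≫ (comul C ⊠₁ 𝟙 (of C))) ≫ coreb C) ◁ (mulAssoc C).hom ⊗≫
    (comul C ≫ (comul C ⊠₁ 𝟙 (of C))) ◁ (rebAdj C).counit ▷ ((mul C ⊠₁ 𝟙 (of C)) ≫ mul C) ⊗≫
    𝟙 (comul C ≫ ((comul C ⊠₁ 𝟙 (of C)) ≫ (mul C ⊠₁ 𝟙 (of C))) ≫ mul C)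

variable {C}

/-- The nearly-tracing axioms for a 2-cell `N` from the bubble `comul ≫ mul` to the identity wire.
The traced wire is the right-hand wire of the bubble. -/
structure IsNearlyTracing (N : comul C ≫ mul C ⟶ 𝟙 (of C)) : Prop where
  /-- Vanishing for the unit: if the traced wire is cut by `I`, then joining it by the counit of
  `one ⊣ coone` and applying `N` is the same as cancelling `I` by the unitors. -/
  vanishing_unit :
    𝟙 ((comul C ≫ (𝟙 (of C) ⊠₁ coone C)) ≫ ((𝟙 (of C) ⊠₁ one C) ≫ mul C)) ⊗≫
        comul C ◁ onRight (oneAdj C).counit ▷ mul C ⊗≫ N =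
      (comulUnit C).hom ▷ ((𝟙 (of C) ⊠₁ one C) ≫ mul C) ≫ codrop C ◁ (mulUnit C).hom ≫
        (dropAdj C).counit
  /-- Vanishing for the tensor: if the traced wire is a pair `y ⊗ z`, then joining the pair by the
  counit of `mul ⊣ comul` and applying `N` once is the same as rebracketing and applying `N`
  twice. -/
  vanishing_tensor :
    𝟙 ((comul C ≫ (𝟙 (of C) ⊠₁ comul C)) ≫ ((𝟙 (of C) ⊠₁ mul C) ≫ mul C)) ⊗≫
        comul C ◁ onRight (mulAdj C).counit ▷ mul C ⊗≫ N =
      rebubble C ⊗≫ comul C ◁ onLeft N ▷ mul C ⊗≫ N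
  /-- Superposing: for a wire to the left of the bubble, tensoring the two by the unit of
  `mul ⊣ comul` (above and below the bubble), rebracketing so that the extra wire is joined to
  the untraced wire of the bubble, and applying `N`, is the same as applying `N` and then
  tensoring. -/
  superposing :
    𝟙 ((𝟙 (of C) ⊠₁ comul C) ≫ (𝟙 (of C) ⊠₁ mul C)) ⊗≫
        (mulAdj C).unit ▷ ((𝟙 (of C) ⊠₁ comul C) ≫ (𝟙 (of C) ⊠₁ mul C)) ⊗≫
        ((mul C ≫ comul C) ≫ (𝟙 (of C) ⊠₁ comul C) ≫ (𝟙 (of C) ⊠₁ mul C)) ◁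
          (mulAdj C).unit ⊗≫
        mul C ◁ rebubble C ▷ comul C ⊗≫
        (mul C ≫ comul C) ◁ onLeft (mulAdj C).counit ▷ (mul C ≫ comul C) ⊗≫
        mul C ◁ N ▷ comul C ⊗≫ 𝟙 (mul C ≫ comul C) =
      onRight N ≫ (mulAdj C).unit

end NearlyTracing

end Prof

namespace Prof

section NearlyTracingCounit

variable (C : Type u) [SmallCategory C] [MonoidalCategory C]

open MonoidalCategory (tensor tensorHom tensorObj rightUnitor associator)

/-! The axioms become identities of ordinary morphisms in `C`. A 2-cell of `Prof` whose source is an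
iterated coend is determined by its values on generators (`hom_ext` with `CoendObj.ind`), and all
the structural 2-cells, adjunction units and counits used here compute definitionally on generators.

For both vanishing axioms a generator is a chain `b ⟶ x' ⊗ y' ⟶ x'' ⊗ w ⟶ x ⊗ y ⟶ a` with maps `k`,
`h₁ ⊗ h₂`, `g₁ ⊗ g₂`, `f`, cut at the object `w` of the traced wire, which is the tensor unit or a
product `y'' ⊗ z''`. Each counit glues a cut by composing the two maps that meet there, so each side
of an axiom is the composite of the whole chain. The sides differ in two ways. One composes wire by
wire before tensoring and the other tensors first, which agree because `⊗` is a bifunctor. One also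
inserts a structural isomorphism and its inverse at the middle of the chain, since a 2-cell acts on
the representable side by an isomorphism and its mate acts on the corepresentable side by the
inverse; these cancel.

The substance of the tensor case is the explicit value of the rebracketing on generators,
`rebubble_pair`. Superposing is then deduced from `nTr_vanishing_tensor`: the rebracketed double
trace reappears there, whiskered between the outer tensorings, and can be traded for a composite
without associators. -/

/-- The value of `rebubble` on generators: conjugation by the associator of `C`. -/
theorem rebubble_pair {a b x y x' y' x'' y'' z'' : C}
    (f : tensorObj x y ⟶ a) (k : b ⟶ tensorObj x' y')
    (g₁ : x'' ⟶ x) (g₂ : tensorObj y'' z'' ⟶ y) (h₁ : x' ⟶ x'') (h₂ : y' ⟶ tensorObj y'' z'') :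
    ((rebubble C).app a).app (op b)
      (pair (P := compProf (comul C) (𝟙 (of C) ⊠₁ comul C))
        (Q := compProf (𝟙 (of C) ⊠₁ mul C) (mul C)) (b := (x'', y'', z''))
        (pair (P := comul C) (Q := 𝟙 (of C) ⊠₁ comul C) (b := (x, y)) f (g₁, g₂))
        (pair (P := 𝟙 (of C) ⊠₁ mul C) (Q := mul C) (b := (x', y')) (h₁, h₂) k)) =
      pair (P := comul C)
        (Q := compProf (compProf (comul C ⊠₁ 𝟙 (of C)) (mul C ⊠₁ 𝟙 (of C))) (mul C))
        (b := (tensorObj x'' y'', z''))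
        ((associator x'' y'' z'').hom ≫ tensorHom g₁ g₂ ≫ f)
        (pair (P := compProf (comul C ⊠₁ 𝟙 (of C)) (mul C ⊠₁ 𝟙 (of C))) (Q := mul C)
          (b := (tensorObj x'' y'', z''))
          (pair (P := comul C ⊠₁ 𝟙 (of C)) (Q := mul C ⊠₁ 𝟙 (of C)) (b := ((x'', y''), z''))
            (𝟙 (tensorObj x'' y''), 𝟙 z'') (𝟙 (tensorObj x'' y''), 𝟙 z''))
          ((k ≫ tensorHom h₁ h₂) ≫ (associator x'' y'' z'').inv)) := by
  -- This middle term is what unfolding literally produces. The inverse comparison isomorphisms for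
  -- composite functors create identity legs. The counit of `rebAdj` composes two of them into `𝟙 ≫
  -- 𝟙` on each of the three wires, and the result is absorbed into the representable factor by its
  -- left action. Only these identities remain to be simplified.
  refine Eq.trans (b := pair (P := comul C)
        (Q := compProf (compProf (comul C ⊠₁ 𝟙 (of C)) (mul C ⊠₁ 𝟙 (of C))) (mul C))
        (b := (tensorObj x'' y'', z''))
        ((associator x'' y'' z'').hom ≫ tensorHom g₁ g₂ ≫ f)
        (pair (P := compProf (comul C ⊠₁ 𝟙 (of C)) (mul C ⊠₁ 𝟙 (of C))) (Q := mul C)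
          (b := (tensorObj x'' y'', z''))
          (pair (P := comul C ⊠₁ 𝟙 (of C)) (Q := mul C ⊠₁ 𝟙 (of C)) (b := ((x'', y''), z''))
            (𝟙 (tensorObj x'' y''), 𝟙 z'')
            (𝟙 (tensorObj x'' y'') ≫ tensorHom (𝟙 x'' ≫ 𝟙 x'') (𝟙 y'' ≫ 𝟙 y''),
              𝟙 z'' ≫ 𝟙 z'' ≫ 𝟙 z''))
          ((k ≫ tensorHom h₁ h₂) ≫ (associator x'' y'' z'').inv))) rfl ?_
  simp

/-- The right unitor lands on the incoming half of the chain and its inverse, from the mate, on the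
outgoing half. The counit of `dropAdj` composes the halves, so the pair cancels. -/
theorem nTr_vanishing_unit :
    𝟙 ((comul C ≫ (𝟙 (of C) ⊠₁ coone C)) ≫ ((𝟙 (of C) ⊠₁ one C) ≫ mul C)) ⊗≫
        comul C ◁ onRight (oneAdj C).counit ▷ mul C ⊗≫ nTr C =
      (comulUnit C).hom ▷ ((𝟙 (of C) ⊠₁ one C) ≫ mul C) ≫ codrop C ◁ (mulUnit C).hom ≫
        (dropAdj C).counit := by
  refine hom_ext ?_
  intro (a : C) b x
  induction x using CoendObj.ind with
  | h m y z =>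
  induction y using CoendObj.ind with
  | h m1 f g =>
  induction z using CoendObj.ind with
  | h m2 h k =>
  obtain ⟨b, rfl⟩ : ∃ c : C, op c = b := ⟨b.unop, rfl⟩
  obtain ⟨x, y⟩ := m1
  obtain ⟨x', y'⟩ := m2
  obtain ⟨x'', y''⟩ := m
  obtain ⟨g₁, g₂⟩ := g
  obtain ⟨h₁, h₂⟩ := h
  -- The components are elements of values of profunctors; read as morphisms of `C`, they can be
  -- composed.
  change tensorObj (C := C) x y ⟶ a at f
  change (b : C) ⟶ tensorObj (C := C) x' y' at k
  change (x'' : C) ⟶ x at g₁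
  change (x' : C) ⟶ x'' at h₁
  change MonoidalCategory.tensorUnit C ⟶ y at g₂
  change (y' : C) ⟶ MonoidalCategory.tensorUnit C at h₂
  -- Both 2-cells evaluated on the generator. On the left, the counit of `oneAdj` has composed `h₂`
  -- and `g₂` through the tensor unit before the outer trace; on the right, the two unitors meet in
  -- the middle.
  change (k ≫ tensorHom (h₁ ≫ g₁) (h₂ ≫ g₂)) ≫ f =
    ((k ≫ tensorHom h₁ h₂) ≫ (rightUnitor (C := C) x'').hom) ≫
      (rightUnitor (C := C) x'').inv ≫ tensorHom g₁ g₂ ≫ f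
  simp

/-- Rebracketing puts the inverse associator before the cut and the associator after it, with only
identities on the wires between. The two remaining traces compose these identities away, and the
associators cancel. -/
theorem nTr_vanishing_tensor :
    𝟙 ((comul C ≫ (𝟙 (of C) ⊠₁ comul C)) ≫ ((𝟙 (of C) ⊠₁ mul C) ≫ mul C)) ⊗≫
        comul C ◁ onRight (mulAdj C).counit ▷ mul C ⊗≫ nTr C =
      rebubble C ⊗≫ comul C ◁ onLeft (nTr C) ▷ mul C ⊗≫ nTr C := by
  refine hom_ext ?_
  intro (a : C) b x
  induction x using CoendObj.ind with
  | h m y z =>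
  induction y using CoendObj.ind with
  | h m1 f g =>
  induction z using CoendObj.ind with
  | h m2 h k =>
  obtain ⟨b, rfl⟩ : ∃ c : C, op c = b := ⟨b.unop, rfl⟩
  obtain ⟨x, y⟩ := m1
  obtain ⟨x', y'⟩ := m2
  obtain ⟨x'', y'', z''⟩ := m
  obtain ⟨g₁, g₂⟩ := g
  obtain ⟨h₁, h₂⟩ := h
  change tensorObj (C := C) x y ⟶ a at f
  change (b : C) ⟶ tensorObj (C := C) x' y' at k
  change (x'' : C) ⟶ x at g₁
  change (x' : C) ⟶ x'' at h₁
  change tensorObj (C := C) y'' z'' ⟶ y at g₂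
  change (y' : C) ⟶ tensorObj (C := C) y'' z'' at h₂
  -- The left side needs no rebracketing: the inner counit composes wire by wire, and the outer one
  -- closes the chain.
  refine Eq.trans (b := (k ≫ tensorHom (h₁ ≫ g₁) (h₂ ≫ g₂)) ≫ f) rfl ?_
  -- The right side is, by definition, the remaining 2-cell applied to the value of `rebubble C`.
  -- That value is replaced by its explicit form, so the rest is evaluated on a simple generator;
  -- the leading `𝟙 _ ⊗≫` supplies the reassociation that followed `rebubble C`.
  refine Eq.trans ?_ (congrArg ((((𝟙 _ ⊗≫ comul C ◁ onLeft (nTr C) ▷ mul C ⊗≫ nTr C :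
      comul C ≫ ((comul C ⊠₁ 𝟙 (of C)) ≫ (mul C ⊠₁ 𝟙 (of C))) ≫ mul C ⟶ 𝟙 (of C)).app a).app (op b)))
    (rebubble_pair C f k g₁ g₂ h₁ h₂)).symm
  refine Eq.trans (b := (((k ≫ tensorHom h₁ h₂) ≫ (associator (C := C) x'' y'' z'').inv) ≫
    tensorHom (𝟙 (tensorObj (C := C) x'' y'') ≫ 𝟙 _) (𝟙 (z'' : C) ≫ 𝟙 _)) ≫
    (associator (C := C) x'' y'' z'').hom ≫ tensorHom g₁ g₂ ≫ f) ?_ rfl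
  simp

/-- Once vanishing for the tensor removes the rebracketing, what is left is a trace on the
right-hand wire, two units, and a counit between them. This is conceptually interchange and a
triangle identity; the check is made on generators. -/
theorem nTr_superposing :
    𝟙 ((𝟙 (of C) ⊠₁ comul C) ≫ (𝟙 (of C) ⊠₁ mul C)) ⊗≫
        (mulAdj C).unit ▷ ((𝟙 (of C) ⊠₁ comul C) ≫ (𝟙 (of C) ⊠₁ mul C)) ⊗≫
        ((mul C ≫ comul C) ≫ (𝟙 (of C) ⊠₁ comul C) ≫ (𝟙 (of C) ⊠₁ mul C)) ◁
          (mulAdj C).unit ⊗≫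
        mul C ◁ rebubble C ▷ comul C ⊗≫
        (mul C ≫ comul C) ◁ onLeft (mulAdj C).counit ▷ (mul C ≫ comul C) ⊗≫
        mul C ◁ nTr C ▷ comul C ⊗≫ 𝟙 (mul C ≫ comul C) =
      onRight (nTr C) ≫ (mulAdj C).unit := by
  -- The rebracketing and the two traces are gathered into one 2-cell whiskered by `mul C` and
  -- `comul C`, so that the right side of the vanishing equation occurs verbatim.
  trans 𝟙 ((𝟙 (of C) ⊠₁ comul C) ≫ (𝟙 (of C) ⊠₁ mul C)) ⊗≫
        (mulAdj C).unit ▷ ((𝟙 (of C) ⊠₁ comul C) ≫ (𝟙 (of C) ⊠₁ mul C)) ⊗≫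
        ((mul C ≫ comul C) ≫ (𝟙 (of C) ⊠₁ comul C) ≫ (𝟙 (of C) ⊠₁ mul C)) ◁
          (mulAdj C).unit ⊗≫
        mul C ◁ (rebubble C ⊗≫ comul C ◁ onLeft (nTr C) ▷ mul C ⊗≫ nTr C) ▷ comul C ⊗≫
          𝟙 (mul C ≫ comul C)
  -- Unfolding makes `nTr C` and the counit of `mulAdj C` the same atom; the regrouping is then pure
  -- bicategorical coherence.
  · unfold nTr
    bicategory
  rw [← nTr_vanishing_tensor]
  refine hom_ext ?_
  intro a b x
  induction x using CoendObj.ind with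
  | h m g h =>
  obtain ⟨⟨b₁, b₂⟩, rfl⟩ : ∃ c : C × C, op c = b := ⟨b.unop, rfl⟩
  obtain ⟨a₁, a₂⟩ := a
  obtain ⟨x'', y'', z''⟩ := m
  obtain ⟨g₁, g₂⟩ := g
  obtain ⟨h₁, h₂⟩ := h
  change (x'' : C) ⟶ a₁ at g₁
  change (b₁ : C) ⟶ x'' at h₁
  change tensorObj (C := C) y'' z'' ⟶ a₂ at g₂
  change (b₂ : C) ⟶ tensorObj (C := C) y'' z'' at h₂
  -- Both sides are represented by pairs over the same object `a₁ ⊗ a₂` with identity first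
  -- component, because the unit of `mulAdj C` produces such a pair. No coend relation is needed:
  -- comparing the second components suffices, and they differ only by tensored identities coming
  -- from the inserted units.
  refine congrArg (pair (P := mul C) (Q := comul C) (a := (a₁, a₂)) (c := op (b₁, b₂))
     (b := tensorObj (C := C) a₁ a₂) (𝟙 (tensorObj (C := C) a₁ a₂)))
    (?_ : tensorHom (𝟙 b₁) (𝟙 b₂) ≫ ((𝟙 (tensorObj b₁ b₂) ≫ tensorHom (h₁ ≫ g₁) (h₂ ≫ g₂)) ≫
      tensorHom (𝟙 a₁) (𝟙 a₂)) = tensorHom (h₁ ≫ g₁) (h₂ ≫ g₂))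
  simp

end NearlyTracingCounit

end Prof

theorem proposition1 (C : Type u) [SmallCategory C] [MonoidalCategory C]
    [IsIdempotentComplete C] : Prof.IsNearlyTracing (Prof.nTr C) where
  vanishing_unit := Prof.nTr_vanishing_unit C
  vanishing_tensor := Prof.nTr_vanishing_tensor C
  superposing := Prof.nTr_superposing C
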